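/- Let $Q\subset\mathbb R^3$ be a cube centred at the origin whose vertices lie on the unit sphere $S^2$, and let $G$ be its octahedral rotation group, i.e. the group of all rotations of $\mathbb R^3$ that map $Q$ onto itself, regarded as a group of transformations of $S^2$. Let $V_O\subset S^2$ be the set of vertices of $Q$, and let $F_O,E_O\subset S^2$ be the central projections (from the origin) to $S^2$ of the centres of the faces and of the midpoints of the edges of $Q$. For $X\in S^2\setminus(V_O\cup F_O\cup E_O)$ let $B_O(X)$ be the $G$-orbit of $X$. Identify $S^2$ with $\widehat{\mathbb C}=\mathbb C\cup\{\infty\}$ by stereographic projection, and for $\alpha\subset S^2$ let $\mathcal A_\alpha$ be the group of all linear fractional transformations $f(z)=\frac{az+b}{cz+d}$, $a,b,c,d\in\mathbb C$, $ad-bc\neq0$, with $f(\alpha)=\alpha$. Then $G\simeq S_4$; the sets $V_O$, $F_O$, $E_O$ are orbits of $G$ with $8$, $6$ and $12$ elements respectively; and every $X\in S^2\setminus(V_O\cup F_O\cup E_O)$ is fixed by no non-trivial element of $G$, so that $|B_O(X)|=24$. Moreover, for every non-empty finite subset $\alpha$ of $S^2$, one has $\mathcal A_\alpha=G$ if and only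 if $\alpha$ is a union of certain elements of $$\{V_O,\,F_O,\,E_O\}\cup\{B_O(X)\mid X\in S^2\setminus(V_O\cup F_O\cup E_O)\}.$$ -/

import Mathlib

open scoped Pointwise

noncomputable section

namespace OctahedralOrbits

/-- Euclidean three-space. -/
abbrev E3 : Type := EuclideanSpace ℝ (Fin 3)

/-- The unit sphere `S²` in Euclidean three-space. -/
abbrev S2 : Type := Metric.sphere (0 : E3) 1

/-- The extended complex plane. -/
abbrev CHat : Type := OnePoint ℂ

theorem S2.coord_sq (X : S2) : X.1 0 ^ 2 + X.1 1 ^ 2 + X.1 2 ^ 2 = 1 := by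
  have h : ‖X.1‖ = 1 := by simp
  have h2 := EuclideanSpace.norm_sq_eq X.1
  rw [h] at h2
  simp only [Fin.sum_univ_three, Real.norm_eq_abs, sq_abs] at h2
  linarith

theorem mem_S2 {x y z : ℝ} (h : x ^ 2 + y ^ 2 + z ^ 2 = 1) :
    (!₂[x, y, z] : E3) ∈ Metric.sphere (0 : E3) 1 := by
  have h2 := EuclideanSpace.norm_sq_eq (!₂[x, y, z] : E3)
  simp [Fin.sum_univ_three] at h2
  rw [mem_sphere_zero_iff_norm]
  have h3 : ‖(!₂[x, y, z] : E3)‖ ^ 2 = 1 := by rw [h2]; exact h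
  have h4 := norm_nonneg (!₂[x, y, z] : E3)
  nlinarith

/-- The north pole of the sphere. -/
def northPole : S2 := ⟨!₂[0, 0, 1], mem_S2 (by norm_num)⟩

/-- Inverse stereographic projection from the north pole, on finite points. -/
def invStereo (z : ℂ) : S2 :=
  ⟨!₂[2 * z.re / (z.re ^ 2 + z.im ^ 2 + 1), 2 * z.im / (z.re ^ 2 + z.im ^ 2 + 1),
      (z.re ^ 2 + z.im ^ 2 - 1) / (z.re ^ 2 + z.im ^ 2 + 1)], mem_S2 (by
    have : z.re ^ 2 + z.im ^ 2 + 1 ≠ 0 := by positivity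
    field_simp
    ring)⟩

open Classical in
/-- The stereographic projection from the north pole, `(x, y, z) ↦ (x + i y) / (1 - z)`, with the
north pole going to `∞`: the usual identification of the unit sphere with the extended complex
plane. -/
def stereo : S2 ≃ CHat where
  toFun X := if X.1 2 = 1 then OnePoint.infty
    else (((⟨X.1 0 / (1 - X.1 2), X.1 1 / (1 - X.1 2)⟩ : ℂ) : ℂ) : CHat)
  invFun w := OnePoint.elim w northPole invStereo
  left_inv X := by
    have hs := S2.coord_sq X
    by_cases h : X.1 2 = 1
    · have h0 : X.1 0 = 0 := by nlinarith [sq_nonneg (X.1 0), sq_nonneg (X.1 1)]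
      have h1 : X.1 1 = 0 := by nlinarith [sq_nonneg (X.1 0), sq_nonneg (X.1 1)]
      simp only [h, if_true, OnePoint.elim_infty]
      apply Subtype.ext
      ext i
      fin_cases i <;> simp [northPole, h, h0, h1]
    · have h' : 1 - X.1 2 ≠ 0 := fun e => h (by linarith)
      simp only [h, if_false, OnePoint.elim_some]
      have hd : (X.1 0 / (1 - X.1 2)) ^ 2 + (X.1 1 / (1 - X.1 2)) ^ 2 + 1 = 2 / (1 - X.1 2) := by
        field_simp
        linarith
      have hn : (X.1 0 / (1 - X.1 2)) ^ 2 + (X.1 1 / (1 - X.1 2)) ^ 2 - 1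
          = 2 * X.1 2 / (1 - X.1 2) := by
        field_simp
        linarith
      apply Subtype.ext
      ext i
      fin_cases i <;> simp only [invStereo, hd, hn] <;> simp <;> field_simp
  right_inv w := by
    induction w using OnePoint.rec with
    | infty => simp [northPole]
    | coe z =>
      have h : z.re ^ 2 + z.im ^ 2 + 1 ≠ 0 := by positivity
      have h1 : (z.re ^ 2 + z.im ^ 2 - 1) / (z.re ^ 2 + z.im ^ 2 + 1) ≠ 1 := by
        rw [Ne, div_eq_iff h]
        intro e
        linarith
      have h2 : 1 - (z.re ^ 2 + z.im ^ 2 - 1) / (z.re ^ 2 + z.im ^ 2 + 1)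
          = 2 / (z.re ^ 2 + z.im ^ 2 + 1) := by
        field_simp
        ring
      simp only [OnePoint.elim_some, invStereo]
      simp [h1, h2]
      apply Complex.ext <;> simp <;> field_simp

/-- The group of linear fractional transformations `z ↦ (a z + b) / (c z + d)`, `ad - bc ≠ 0`, as
a group of permutations of the extended complex plane. -/
def linearFractional : Subgroup (Equiv.Perm CHat) :=
  (MulAction.toPermHom (GL (Fin 2) ℂ) CHat).range

/-- For a subset `α` of the sphere, the group of all linear fractional transformations `f` with
`f(α) = α`, where the sphere is identified with the extended complex plane by stereographic
projection. -/
def fixGroup (α : Set S2) : Subgroup (Equiv.Perm S2) :=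
  (linearFractional ⊓ MulAction.stabilizer (Equiv.Perm CHat) (stereo '' α)).comap
    stereo.permCongrHom.toMonoidHom

/-- The cube centred at the origin with vertices on the unit sphere and with axes given by the
orthonormal basis `b`: its vertex with signs `ε`. -/
def cubeVertex (b : OrthonormalBasis (Fin 3) ℝ E3) (ε : Fin 3 → ℤˣ) : E3 :=
  (1 / √3 : ℝ) • ∑ i, ((ε i : ℤ) : ℝ) • b i

/-- The solid cube. -/
def cube (b : OrthonormalBasis (Fin 3) ℝ E3) : Set E3 :=
  convexHull ℝ (Set.range (cubeVertex b))

/-- The centre of the face of the cube on which the `i`-th sign is `s`. -/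
def faceCenter (b : OrthonormalBasis (Fin 3) ℝ E3) (i : Fin 3) (s : ℤˣ) : E3 :=
  (Finset.univ.filter (fun ε : Fin 3 → ℤˣ => ε i = s)).centroid ℝ (cubeVertex b)

/-- The midpoint of the edge of the cube that starts at the vertex with signs `ε` and has
direction `b i`. -/
def edgeMidpoint (b : OrthonormalBasis (Fin 3) ℝ E3) (ε : Fin 3 → ℤˣ) (i : Fin 3) : E3 :=
  midpoint ℝ (cubeVertex b ε) (cubeVertex b (Function.update ε i (-ε i)))

/-- The central projection from the origin to the unit sphere (for `x ≠ 0`). -/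
def radial (x : E3) : E3 := ‖x‖⁻¹ • x

/-- The vertices of the cube. -/
def VO (b : OrthonormalBasis (Fin 3) ℝ E3) : Set S2 :=
  {X | ∃ ε, (X : E3) = cubeVertex b ε}

/-- The central projections to the sphere of the centres of the faces of the cube. -/
def FO (b : OrthonormalBasis (Fin 3) ℝ E3) : Set S2 :=
  {X | ∃ i s, (X : E3) = radial (faceCenter b i s)}

/-- The central projections to the sphere of the midpoints of the edges of the cube. -/
def EO (b : OrthonormalBasis (Fin 3) ℝ E3) : Set S2 :=
  {X | ∃ ε i, (X : E3) = radial (edgeMidpoint b ε i)}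

/-- The octahedral group: the rotations of three-space that map the cube onto itself, as
transformations of the sphere. -/
def octahedralGroup (b : OrthonormalBasis (Fin 3) ℝ E3) : Subgroup (Equiv.Perm S2) where
  carrier := {g | ∃ R : E3 ≃ₗᵢ[ℝ] E3, LinearMap.det (R.toLinearEquiv : E3 →ₗ[ℝ] E3) = 1 ∧
    R '' cube b = cube b ∧ ∀ X : S2, (g X : E3) = R X}
  mul_mem' := by
    rintro g h ⟨R, hR, hRc, hg⟩ ⟨T, hT, hTc, hh⟩
    refine ⟨T.trans R, ?_, ?_, fun X => ?_⟩
    · have : ((T.trans R).toLinearEquiv : E3 →ₗ[ℝ] E3)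
          = (R.toLinearEquiv : E3 →ₗ[ℝ] E3) ∘ₗ (T.toLinearEquiv : E3 →ₗ[ℝ] E3) := rfl
      rw [this, LinearMap.det_comp, hR, hT, one_mul]
    · rw [LinearIsometryEquiv.coe_trans, Set.image_comp, hTc, hRc]
    · simp [hg, hh]
  one_mem' := ⟨LinearIsometryEquiv.refl ℝ E3, by
    have : ((LinearIsometryEquiv.refl ℝ E3).toLinearEquiv : E3 →ₗ[ℝ] E3) = LinearMap.id := rfl
    rw [this, LinearMap.det_id], by simp, fun X => by simp⟩
  inv_mem' := by
    rintro g ⟨R, hR, hRc, hg⟩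
    refine ⟨R.symm, ?_, ?_, fun X => ?_⟩
    · have h := LinearEquiv.det_mul_det_symm R.toLinearEquiv
      rw [hR, one_mul] at h
      exact h
    · conv_lhs => rw [← hRc]
      rw [← Set.image_comp]
      simp
    · apply R.injective
      rw [← hg, LinearIsometryEquiv.apply_symm_apply]
      simp

/-- The orbit of a point of the sphere under the octahedral group. -/
def BO (b : OrthonormalBasis (Fin 3) ℝ E3) (X : S2) : Set S2 :=
  MulAction.orbit (octahedralGroup b) X

end OctahedralOrbits

end

/-! If `fixGroup α` is the octahedral group G, then α is G-invariant, hence a union of G-orbits, and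
the orbits are exactly the listed sets.

Conversely, let α be a finite non-empty union of listed orbits. Each has more than two points, and a
linear fractional map is determined by its values at three points, so H = `fixGroup α` is finite
(`finite_fixGroup`). It contains G, because rotations are linear fractional in the stereographic
coordinate (`stereo_isometry`). It remains to see that G is maximal among finite groups of such maps
(`eq_octahedralGroup_of_le`). A non-trivial element of finite order has exactly two fixed points,
since parabolic maps have infinite order. Burnside's lemma on the points with non-trivial stabilizer
then gives three orbits, of total size |H| + 2. The H-stabilizers of a vertex and of a face centre
have orders divisible by 3 and by 4, because they contain those in G; this leaves only |H| = 24.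

G itself is made explicit by 24 integer matrices indexed by the permutations of the four diagonals
(`octMatrix`), so its orbits and rotation axes are found by finite checks. -/

noncomputable section

namespace OctahedralOrbits

/-! ### Fixed points of linear fractional transformations -/

section Moebius

open OnePoint Matrix

/-- A linear fractional transformation other than the identity has at most two fixed points, and
these are distinct if its discriminant does not vanish. -/
theorem exists_fixed_pair (g : GL (Fin 2) ℂ) (hg : ∃ x : CHat, g • x ≠ x) :
    ∃ p q : CHat, (∀ x : CHat, g • x = x ↔ x = p ∨ x = q) ∧ (g.val.discr ≠ 0 → p ≠ q) := by
  have key : ∀ z : ℂ, g • (z : CHat) = z ↔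
      g 1 0 * z ^ 2 + (g 1 1 - g 0 0) * z - g 0 1 = 0 := by
    intro z
    rw [← GeneralLinearGroup.fixpointPolynomial_aeval_eq_zero_iff]
    simp [GeneralLinearGroup.fixpointPolynomial]
  have hd : g.val.discr = (g 0 0 - g 1 1) ^ 2 + 4 * g 0 1 * g 1 0 := by
    rw [discr_fin_two, trace_fin_two, det_fin_two]; ring
  by_cases hc : g 1 0 = 0
  · by_cases ha : g 1 1 - g 0 0 = 0
    -- A translation, non-trivial by `hg`: its double fixed point ∞ is listed twice.
    · refine ⟨∞, ∞, fun x => ?_, fun h => ?_⟩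
      · induction x using OnePoint.rec with
        | infty => simp [smul_infty_eq_self_iff, hc]
        | coe z =>
          rw [key]
          simp only [hc, ha, coe_ne_infty, or_self, iff_false]
          intro hb
          obtain ⟨x, hx⟩ := hg
          apply hx
          induction x using OnePoint.rec with
          | infty => exact smul_infty_eq_self_iff.2 hc
          | coe w => rw [key, hc, ha]; linear_combination hb
      · exfalso
        apply h
        rw [hd, hc]
        linear_combination (g 1 1 - g 0 0) * ha
    · refine ⟨∞, ((g 0 1 / (g 1 1 - g 0 0) : ℂ) : CHat), fun x => ?_, fun _ => (coe_ne_infty _).symm⟩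
      induction x using OnePoint.rec with
      | infty => simp [smul_infty_eq_self_iff, hc]
      | coe z =>
        rw [key, hc]
        simp only [coe_ne_infty, OnePoint.coe_eq_coe, false_or]
        rw [eq_div_iff ha]
        constructor <;> intro h <;> linear_combination h
  · obtain ⟨s, hs⟩ := IsSquare.exists_sq _ (IsAlgClosed.exists_eq_mul_self g.val.discr)
    refine ⟨(((-(g 1 1 - g 0 0) + s) / (2 * g 1 0) : ℂ) : CHat),
      (((-(g 1 1 - g 0 0) - s) / (2 * g 1 0) : ℂ) : CHat), fun x => ?_, fun h => ?_⟩
    · induction x using OnePoint.rec with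
      | infty => simp [smul_infty_eq_self_iff, hc]
      | coe z =>
        rw [key]
        simp only [OnePoint.coe_eq_coe]
        have := quadratic_eq_zero_iff (a := g 1 0) (b := g 1 1 - g 0 0) (c := - g 0 1) hc (s := s)
          (by rw [discrim]; linear_combination hs - hd) z
        rw [← this]
        constructor <;> intro h <;> linear_combination h
    · rw [Ne, OnePoint.coe_eq_coe]
      intro e
      have h2 : 2 * g 1 0 ≠ 0 := mul_ne_zero two_ne_zero hc
      rw [div_left_inj' h2] at e
      have : s = 0 := by linear_combination e / 2
      exact h (by rw [hs, this]; ring)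

/-- A linear fractional transformation of finite order other than the identity has exactly two
fixed points. -/
theorem ncard_fixed_eq_two (g : GL (Fin 2) ℂ) (hg : ∃ x : CHat, g • x ≠ x) {n : ℕ} (hn : n ≠ 0)
    (hgn : ∀ x : CHat, g ^ n • x = x) : {x : CHat | g • x = x}.ncard = 2 := by
  obtain ⟨p, q, h, hpq⟩ := exists_fixed_pair g hg
  have hset : {x : CHat | g • x = x} = {p, q} := by
    ext x
    simp [h]
  rw [hset]
  apply Set.ncard_pair
  apply hpq
  intro hdisc
  -- A zero discriminant makes a non-scalar matrix parabolic. Its non-zero powers are parabolic too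
  -- and fix a single point, whereas `g ^ n` fixes both 0 and ∞.
  have hpar : g.IsParabolic := by
    refine ⟨?_, hdisc⟩
    rintro ⟨a, ha⟩
    obtain ⟨x, hx⟩ := hg
    have e : ∀ i j, g i j = scalar (Fin 2) a i j := fun i j => by rw [ha]
    have h0 : a ≠ 0 := by
      rintro rfl
      apply g.det_ne_zero
      rw [← ha]
      simp
    apply hx
    induction x using OnePoint.rec with
    | infty => exact smul_infty_eq_self_iff.2 (by rw [e]; simp)
    | coe z =>
      rw [smul_some_eq_ite]
      simp [e, h0]
  have h3 := hpar.pow hn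
  have h0 := (h3.smul_eq_self_iff (c := (((0 : ℂ)) : CHat))).1 (hgn _)
  have h1 := (h3.smul_eq_self_iff (c := (∞ : CHat))).1 (hgn _)
  exact coe_ne_infty _ (h0.trans h1.symm)

theorem linearFractional_three_fixed {f : Equiv.Perm CHat} (hf : f ∈ linearFractional)
    {x y z : CHat} (hxy : x ≠ y) (hxz : x ≠ z) (hyz : y ≠ z) (hx : f x = x) (hy : f y = y)
    (hz : f z = z) : f = 1 := by
  obtain ⟨g, rfl⟩ := hf
  by_contra hne
  have hg : ∃ x : CHat, g • x ≠ x := by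
    by_contra! h
    exact hne (Equiv.ext h)
  obtain ⟨p, q, h, -⟩ := exists_fixed_pair g hg
  have hx' := (h x).1 hx
  have hy' := (h y).1 hy
  have hz' := (h z).1 hz
  grind

theorem linearFractional_ncard_fixed {f : Equiv.Perm CHat} (hf : f ∈ linearFractional)
    (hne : f ≠ 1) (hfin : IsOfFinOrder f) : {x | f x = x}.ncard = 2 := by
  obtain ⟨n, hn, hfn⟩ := isOfFinOrder_iff_pow_eq_one.1 hfin
  obtain ⟨g, rfl⟩ := hf
  refine ncard_fixed_eq_two g ?_ hn.ne' fun x => ?_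
  · by_contra! h
    exact hne (Equiv.ext h)
  · rw [← map_pow] at hfn
    exact DFunLike.congr_fun hfn x

/-- The linear fractional transformations as permutations of the sphere. -/
def sphereMoebius : Subgroup (Equiv.Perm S2) :=
  linearFractional.comap stereo.permCongrHom.toMonoidHom

theorem mem_sphereMoebius {f : Equiv.Perm S2} :
    f ∈ sphereMoebius ↔ stereo.permCongrHom f ∈ linearFractional := Iff.rfl

theorem sphereMoebius_three_fixed {f : Equiv.Perm S2} (hf : f ∈ sphereMoebius)
    {x y z : S2} (hxy : x ≠ y) (hxz : x ≠ z) (hyz : y ≠ z) (hx : f x = x) (hy : f y = y)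
    (hz : f z = z) : f = 1 := by
  have := linearFractional_three_fixed (mem_sphereMoebius.1 hf) (stereo.injective.ne hxy)
    (stereo.injective.ne hxz) (stereo.injective.ne hyz) (by simp [hx])
    (by simp [hy]) (by simp [hz])
  exact (map_eq_one_iff stereo.permCongrHom stereo.permCongrHom.injective).1 this

theorem sphereMoebius_ncard_fixed {f : Equiv.Perm S2} (hf : f ∈ sphereMoebius)
    (hne : f ≠ 1) (hfin : IsOfFinOrder f) : {x | f x = x}.ncard = 2 := by
  have h := linearFractional_ncard_fixed (mem_sphereMoebius.1 hf) 
    ((map_eq_one_iff stereo.permCongrHom stereo.permCongrHom.injective).not.2 hne)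
    (by simpa using stereo.permCongrHom.toMonoidHom.isOfFinOrder hfin)
  rw [← h, ← Set.ncard_image_of_injective _ stereo.injective]
  congr 1
  ext x
  simp only [Set.mem_image, Set.mem_ofPred_eq]
  constructor
  · rintro ⟨y, hy, rfl⟩
    simp [hy]
  · intro hx
    refine ⟨stereo.symm x, ?_, by simp⟩
    apply stereo.injective
    simpa using hx

theorem mem_fixGroup {α : Set S2} {f : Equiv.Perm S2} :
    f ∈ fixGroup α ↔ f ∈ sphereMoebius ∧ f '' α = α := by
  rw [fixGroup, Subgroup.mem_comap, Subgroup.mem_inf, mem_sphereMoebius]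
  refine and_congr Iff.rfl ?_
  rw [MulAction.mem_stabilizer_iff]
  have : (stereo.permCongrHom.toMonoidHom f) • (stereo '' α) = stereo '' (f '' α) := by
    rw [← Set.image_smul, Set.image_image, Set.image_image]
    simp
  rw [this]
  exact stereo.injective.image_injective.eq_iff

/-- Restriction to α is injective, because two elements that agree at three points are equal; and α
has only finitely many self-maps. -/
theorem finite_fixGroup {α : Set S2} (hα : α.Finite) (h3 : 2 < α.ncard) :
    Finite (fixGroup α) := by
  have := hα.to_subtype
  have hmap : ∀ f : fixGroup α, ∀ x : α, f.1 x.1 ∈ α := fun f x => by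
    have h := (mem_fixGroup.1 f.2).2
    have : f.1 x.1 ∈ f.1 '' α := Set.mem_image_of_mem _ x.2
    rwa [h] at this
  refine Finite.of_injective (fun (f : fixGroup α) (x : α) => (⟨f.1 x.1, hmap f x⟩ : α)) ?_
  intro f g hfg
  obtain ⟨x, y, z, hx, hy, hz, hxy, hxz, hyz⟩ := (Set.two_lt_ncard_iff hα).1 h3
  have e : ∀ w ∈ α, (g.1⁻¹ * f.1) w = w := fun w hw => by
    have := congrArg Subtype.val (congrFun hfg ⟨w, hw⟩)
    rw [Equiv.Perm.mul_apply, Equiv.Perm.inv_eq_iff_eq]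
    exact this
  have := sphereMoebius_three_fixed (mul_mem (inv_mem (mem_fixGroup.1 g.2).1)
    (mem_fixGroup.1 f.2).1) hxy hxz hyz (e x hx) (e y hy) (e z hz)
  exact Subtype.ext (inv_mul_eq_one.1 this).symm

end Moebius

/-! ### Burnside counting for groups whose elements have two fixed points -/

section Counting

/-- The arithmetic of three orbits of sizes `x`, `y`, `z` with stabilizers of orders `n`, `m`, `k`
in a group of order `N`. -/
theorem card_eq_of_three_orbits {N x y z n m k : ℕ} (hN : 0 < N) (hx : x * n = N) (hy : y * m = N)
    (hz : z * k = N) (hn : 4 ∣ n) (hm : 3 ∣ m) (hk : 2 ≤ k) (h : x + y + z = N + 2) : N = 24 := by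
  obtain ⟨n, rfl⟩ := hn
  obtain ⟨m, rfl⟩ := hm
  have hn0 : 0 < n := by rcases Nat.eq_zero_or_pos n with rfl | h <;> omega
  have hm0 : 0 < m := by rcases Nat.eq_zero_or_pos m with rfl | h <;> omega
  have h1 : 4 * x ≤ N := by nlinarith
  have h2 : 3 * y ≤ N := by nlinarith
  -- From here `n` and `m` are the cofactors in the stabilizer orders 4n and 3m. Raising any of the
  -- orders 4, 3, 2 to its next value brings the sum of orbit sizes below N: 1/8 + 1/3 + 1/2, 1/4 +
  -- 1/6 + 1/2 and 1/4 + 1/3 + 1/3 are all less than 1.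
  have h3 : n < 2 := by
    by_contra! hc
    have : 8 * x ≤ N := by nlinarith
    have : 2 * z ≤ N := by nlinarith
    omega
  have h4 : m < 2 := by
    by_contra! hc
    have : 6 * y ≤ N := by nlinarith
    have : 2 * z ≤ N := by nlinarith
    omega
  have h5 : k < 3 := by
    by_contra! hc
    have : 3 * z ≤ N := by nlinarith
    omega
  obtain rfl : n = 1 := by omega
  obtain rfl : m = 1 := by omega
  obtain rfl : k = 2 := by omega
  omega

open MulAction

theorem card_quotient_orbit_mul_card_stabilizer {H X : Type*} [Group H] [Finite H]
    [MulAction H X] (x : X) :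
    Nat.card (orbitRel.Quotient.orbit (Quotient.mk'' x : orbitRel.Quotient H X))
      * Nat.card (stabilizer H x) = Nat.card H := by
  rw [orbitRel.Quotient.orbit_mk, ← Nat.card_prod,
    Nat.card_congr (orbitProdStabilizerEquivGroup H x)]

/-- Burnside's lemma for a finite group all of whose non-trivial elements have exactly two fixed
points. -/
theorem card_add_eq_card_quotient_mul {H X : Type*} [Group H] [Finite H] [Finite X]
    [MulAction H X] (hfix : ∀ h : H, h ≠ 1 → (fixedBy X h).ncard = 2) :
    Nat.card X + 2 * (Nat.card H - 1) = Nat.card (orbitRel.Quotient H X) * Nat.card H := by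
  classical
  have := Fintype.ofFinite H
  have := Fintype.ofFinite X
  have := Fintype.ofFinite (orbitRel.Quotient H X)
  have := fun h : H => Fintype.ofFinite (fixedBy X h)
  have h := sum_card_fixedBy_eq_card_orbits_mul_card_group H X
  simp only [← Nat.card_eq_fintype_card] at h
  rw [← h, ← Finset.add_sum_erase _ _ (Finset.mem_univ (1 : H)),
    Finset.sum_congr rfl (g := fun _ => 2)]
  · have : fixedBy X (1 : H) = Set.univ := by ext x; simp
    rw [this, Finset.sum_const, Finset.card_erase_of_mem (Finset.mem_univ _), Finset.card_univ,
      Nat.card_univ, smul_eq_mul, mul_comm, Nat.card_eq_fintype_card (α := H)]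
  · intro g hg
    exact hfix g (Finset.ne_of_mem_erase hg)

/-- With N = |H| and r orbits, Burnside gives |X| = (r - 2)N + 2. Orbits have at most N/2 points,
which forces r < 4, while |X| > 2 forces r > 2. Hence r = 3 and |X| = N + 2. -/
theorem card_eq_of_fixed_points_of_finite {H X : Type*} [Group H] [Finite H] [Finite X]
    [MulAction H X] (hfix : ∀ h : H, h ≠ 1 → (fixedBy X h).ncard = 2)
    (hstab : ∀ x : X, 2 ≤ Nat.card (stabilizer H x)) (v f : X)
    (hv : 3 ∣ Nat.card (stabilizer H v)) (hf : 4 ∣ Nat.card (stabilizer H f))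
    (hf2 : 2 < Nat.card (orbit H f)) : Nat.card H = 24 := by
  classical
  have := Fintype.ofFinite (orbitRel.Quotient H X)
  have hN : 0 < Nat.card H := Nat.card_pos
  have hB := card_add_eq_card_quotient_mul hfix
  have hst := card_quotient_orbit_mul_card_stabilizer (H := H) (X := X)
  have hsum : Nat.card X = ∑ ω : orbitRel.Quotient H X, Nat.card ω.orbit := by
    rw [Nat.card_congr (selfEquivSigmaOrbits' H X), Nat.card_sigma]
  set s : orbitRel.Quotient H X → ℕ := fun ω => Nat.card ω.orbit with hs
  have hrep : ∀ ω, ∃ t, 2 ≤ t ∧ s ω * t = Nat.card H := fun ω => by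
    induction ω using Quotient.inductionOn' with
    | h x => exact ⟨_, hstab x, hst x⟩
  have hle : ∀ ω, 2 * s ω ≤ Nat.card H := fun ω => by
    obtain ⟨t, ht, e⟩ := hrep ω
    nlinarith
  have hsum2 : 2 * Nat.card X ≤ Nat.card (orbitRel.Quotient H X) * Nat.card H := by
    rw [hsum, Finset.mul_sum, Nat.card_eq_fintype_card (α := orbitRel.Quotient H X)]
    exact (Finset.sum_le_card_nsmul _ _ _ fun ω _ => hle ω)
  have hX : 2 < Nat.card X := hf2.trans_le (Nat.card_mono Set.finite_univ (Set.subset_univ _) |>.trans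
    (Nat.card_univ).le)
  have hr : Nat.card (orbitRel.Quotient H X) = 3 := by
    obtain ⟨N, hN'⟩ : ∃ N, Nat.card H = N + 1 := ⟨_, (Nat.succ_pred_eq_of_pos hN).symm⟩
    rw [hN'] at hB hsum2
    rw [Nat.add_sub_cancel] at hB
    generalize Nat.card (orbitRel.Quotient H X) = r at *
    apply le_antisymm
    · by_contra! h
      nlinarith
    · by_contra! h
      nlinarith
  rw [hr, hsum] at hB
  have hf3 : 2 < s (Quotient.mk'' f) := by
    simpa only [hs, orbitRel.Quotient.orbit_mk] using hf2
  by_cases hvf : (Quotient.mk'' v : orbitRel.Quotient H X) = Quotient.mk'' f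
  -- A common orbit of `v` and `f` has stabilizers of order divisible by 12, so at most N/12 points.
  -- The other two orbits each have N/2 or at most N/3 points. A total of N + 2 needs N/2 twice,
  -- leaving 2 points for the orbit of `f`, against `hf2`.
  · exfalso
    have h12 : 12 ∣ Nat.card (stabilizer H f) := by
      have e := hst v
      rw [hvf, ← hst f] at e
      rw [Nat.eq_of_mul_eq_mul_left (by change 0 < s _; omega) e] at hv
      omega
    have hcard : (Finset.univ.erase (Quotient.mk'' f : orbitRel.Quotient H X)).card = 2 := by
      rw [Finset.card_erase_of_mem (Finset.mem_univ _), Finset.card_univ,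
        ← Nat.card_eq_fintype_card, hr]
    obtain ⟨b, c, hbc, he⟩ := Finset.card_eq_two.1 hcard
    rw [← Finset.add_sum_erase _ _ (Finset.mem_univ (Quotient.mk'' f)), he,
      Finset.sum_pair hbc] at hB
    have hfN : 12 * s (Quotient.mk'' f) ≤ Nat.card H := by
      obtain ⟨k, hk⟩ := h12
      have e := hst f
      rw [hk] at e
      change s _ * _ = _ at e
      have : 0 < k := by
        rcases Nat.eq_zero_or_pos k with rfl | h
        · omega
        · exact h
      nlinarith
    have hb := hle b
    have hc := hle c
    have aux : ∀ ω, 3 * s ω ≤ Nat.card H ∨ 2 * s ω = Nat.card H := fun ω => by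
      obtain ⟨t, ht, e⟩ := hrep ω
      rcases eq_or_lt_of_le ht with rfl | h
      · right; omega
      · left; nlinarith
    change s _ + (s _ + s _) + _ = _ at hB
    have := aux b
    have := aux c
    omega
  · have hcard : ((Finset.univ.erase (Quotient.mk'' f : orbitRel.Quotient H X)).erase
        (Quotient.mk'' v)).card = 1 := by
      rw [Finset.card_erase_of_mem (Finset.mem_erase.2 ⟨hvf, Finset.mem_univ _⟩),
        Finset.card_erase_of_mem (Finset.mem_univ _), Finset.card_univ,
        ← Nat.card_eq_fintype_card, hr]
    obtain ⟨c, he⟩ := Finset.card_eq_one.1 hcard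
    rw [← Finset.add_sum_erase _ _ (Finset.mem_univ (Quotient.mk'' f)),
      ← Finset.add_sum_erase _ _ (Finset.mem_erase.2 ⟨hvf, Finset.mem_univ _⟩), he,
      Finset.sum_singleton] at hB
    obtain ⟨t, ht, e⟩ := hrep c
    refine card_eq_of_three_orbits hN (hst f) (hst v) e hf hv ht ?_
    change s _ + (s _ + s _) + _ = _ at hB
    change s _ + s _ + s _ = _
    omega

/-- A finite group all of whose non-trivial elements have exactly two fixed points has order `24`
if it has stabilizers of orders divisible by `3` and by `4`, the latter not of an orbit of at most
two points. -/
theorem card_eq_of_fixed_points {H X : Type*} [Group H] [Finite H] [MulAction H X]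
    (hfix : ∀ h : H, h ≠ 1 → (fixedBy X h).ncard = 2) (v f : X)
    (hv : 3 ∣ Nat.card (stabilizer H v)) (hf : 4 ∣ Nat.card (stabilizer H f))
    (hf2 : 2 < Nat.card (orbit H f)) : Nat.card H = 24 := by
  classical
  -- Restricting to points with non-trivial stabilizer loses no fixed point of a non-trivial
  -- element. It leaves a finite set, as finitely many elements fix two points each.
  set P : SubMulAction H X :=
    { carrier := {x | stabilizer H x ≠ ⊥}
      smul_mem' := fun g x hx e => hx (by
        rw [stabilizer_smul_eq_stabilizer_map_conj, Subgroup.map_eq_bot_iff_of_injective _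
          (MulAut.conj g).injective] at e
        exact e) } with hP
  have hPm : ∀ x, x ∈ P ↔ stabilizer H x ≠ ⊥ := fun _ => Iff.rfl
  have hfixP : ∀ h : H, h ≠ 1 → ∀ x, h • x = x → x ∈ P := fun h hh x hx => by
    rw [hPm, Ne, Subgroup.eq_bot_iff_forall]
    exact fun hb => hh (hb h hx)
  have hPfin : (P : Set X).Finite := by
    refine (Set.finite_iUnion (f := fun h : {h : H // h ≠ 1} => fixedBy X h.1)
      fun h => Set.finite_of_ncard_ne_zero (by rw [hfix h.1 h.2]; norm_num)).subset ?_
    intro x hx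
    obtain ⟨h, hh⟩ := Subgroup.ne_bot_iff_exists_ne_one.1 hx
    exact Set.mem_iUnion.2 ⟨⟨h.1, fun e => hh (Subtype.ext e)⟩, h.2⟩
  have : Finite P := hPfin
  have hmem : ∀ x, Nat.card (stabilizer H x) ≠ 1 → x ∈ P := fun x hx e => hx (by
    rw [e]; simp)
  have hvP : v ∈ P := hmem v (by omega)
  have hfP : f ∈ P := hmem f (by omega)
  refine card_eq_of_fixed_points_of_finite (X := P) (fun h hh => ?_) (fun x => ?_) ⟨v, hvP⟩
    ⟨f, hfP⟩ ?_ ?_ ?_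
  · rw [← hfix h hh, ← Set.ncard_image_of_injective _ Subtype.val_injective]
    congr 1
    ext x
    simp only [Set.mem_image, mem_fixedBy]
    constructor
    · rintro ⟨y, hy, rfl⟩
      exact congrArg Subtype.val hy
    · exact fun hx => ⟨⟨x, hfixP h hh x hx⟩, Subtype.ext hx, rfl⟩
  · rw [SubMulAction.stabilizer_of_subMul]
    have h1 := x.2
    rw [hPm, Ne, ← Subgroup.card_eq_one] at h1
    have h2 : 0 < Nat.card (stabilizer H x.1) := Nat.card_pos
    omega
  · rwa [SubMulAction.stabilizer_of_subMul]
  · rwa [SubMulAction.stabilizer_of_subMul]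
  · have := SubMulAction.val_image_orbit (p := P) ⟨f, hfP⟩
    rwa [← this, Nat.card_image_of_injective Subtype.val_injective] at hf2

end Counting

/-! ### Rotations of the sphere as linear fractional transformations -/

section Rotations

open OnePoint Matrix ComplexConjugate

/-- The permutation of the sphere induced by a linear isometry. -/
def spherePerm : (E3 ≃ₗᵢ[ℝ] E3) →* Equiv.Perm S2 where
  toFun R :=
    { toFun := fun X => ⟨R X, by simp⟩
      invFun := fun X => ⟨R.symm X, by simp⟩
      left_inv := fun X => by simp
      right_inv := fun X => by simp }
  map_one' := rfl
  map_mul' _ _ := rfl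

@[simp]
theorem coe_spherePerm (R : E3 ≃ₗᵢ[ℝ] E3) (X : S2) : (spherePerm R X : E3) = R X := rfl

/-- The determinant of a linear isometry of three-space. -/
def isomDet (R : E3 ≃ₗᵢ[ℝ] E3) : ℝ := LinearMap.det (R.toLinearEquiv : E3 →ₗ[ℝ] E3)

theorem isomDet_mul (R T : E3 ≃ₗᵢ[ℝ] E3) : isomDet (R * T) = isomDet R * isomDet T := by
  have : ((R * T).toLinearEquiv : E3 →ₗ[ℝ] E3)
      = (R.toLinearEquiv : E3 →ₗ[ℝ] E3) ∘ₗ (T.toLinearEquiv : E3 →ₗ[ℝ] E3) := rfl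
  rw [isomDet, this, LinearMap.det_comp, isomDet, isomDet]

theorem isomDet_one : isomDet 1 = 1 := by
  have : ((1 : E3 ≃ₗᵢ[ℝ] E3).toLinearEquiv : E3 →ₗ[ℝ] E3) = LinearMap.id := rfl
  rw [isomDet, this, LinearMap.det_id]

/-- A criterion for a point of the sphere to have given homogeneous coordinates. -/
theorem stereo_eq_ite {X : S2} {p q : ℂ} (h0 : p ≠ 0 ∨ q ≠ 0)
    (h1 : p * (1 - X.1 2) = q * (X.1 0 + X.1 1 * Complex.I))
    (h2 : p * (X.1 0 - X.1 1 * Complex.I) = q * (1 + X.1 2)) :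
    stereo X = if q = 0 then (∞ : CHat) else ((p / q : ℂ) : CHat) := by
  have hs := S2.coord_sq X
  -- X has homogeneous coordinates [x + iy : 1 - z] = [1 + z : x - iy]. At the north pole `h1` is
  -- void and `h2` decides.
  by_cases hX : X.1 2 = 1
  · have e0 : X.1 0 = 0 := by nlinarith [sq_nonneg (X.1 0), sq_nonneg (X.1 1)]
    have e1 : X.1 1 = 0 := by nlinarith [sq_nonneg (X.1 0), sq_nonneg (X.1 1)]
    rw [hX, e0, e1] at h2
    have hq : q = 0 := by
      push_cast at h2
      linear_combination -h2 / 2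
    simp [stereo, hX, hq]
  · have hX' : (1 - X.1 2 : ℂ) ≠ 0 := by
      intro e
      apply hX
      have : ((1 - X.1 2 : ℝ) : ℂ) = 0 := by push_cast; exact e
      have := Complex.ofReal_eq_zero.1 this
      linarith
    have hq : q ≠ 0 := by
      rintro rfl
      rw [zero_mul, mul_eq_zero] at h1
      rcases h1 with h1 | h1
      · simp [h1] at h0
      · exact hX' h1
    have : (⟨X.1 0 / (1 - X.1 2), X.1 1 / (1 - X.1 2)⟩ : ℂ)
        = (X.1 0 + X.1 1 * Complex.I) / (1 - X.1 2) := by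
      rw [Complex.mk_eq_add_mul_I]
      push_cast
      ring
    simp only [stereo, Equiv.coe_fn_mk, hX, if_false, hq, this, OnePoint.coe_eq_coe]
    rw [div_eq_div_iff hX' hq]
    linear_combination -h1

/-- The matrix of the reflection in the plane orthogonal to `v`, following complex conjugation. -/
def reflMatrix (v : E3) (hv : v ≠ 0) : GL (Fin 2) ℂ :=
  Matrix.GeneralLinearGroup.mkOfDetNeZero
    -- The mirror circle v · X = 0 has equation v₂ z z̄ + (v₀ - i v₁) z + (v₀ + i v₁) z̄ - v₂ = 0.
    -- Solving it for z as a function of z̄ gives this matrix, with determinant -|v|².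
    !![-(v 0 + v 1 * Complex.I), (v 2 : ℂ); (v 2 : ℂ), v 0 - v 1 * Complex.I] (by
      rw [det_fin_two_of]
      have h : v 0 ^ 2 + v 1 ^ 2 + v 2 ^ 2 ≠ 0 := by
        intro h
        apply hv
        ext i
        fin_cases i <;> simp <;>
          nlinarith [sq_nonneg (v 0), sq_nonneg (v 1), sq_nonneg (v 2)]
      have h' : ((v 0 ^ 2 + v 1 ^ 2 + v 2 ^ 2 : ℝ) : ℂ) ≠ 0 := Complex.ofReal_ne_zero.2 h
      intro e
      apply h'
      push_cast
      linear_combination -e + (v 1) ^ 2 * Complex.I_sq)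

theorem stereo_reflection (v : E3) (hv : v ≠ 0) (X : S2) :
    stereo (spherePerm (Submodule.reflection (ℝ ∙ v)ᗮ) X)
      = reflMatrix v hv • OnePoint.map conj (stereo X) := by
  have hs := S2.coord_sq X
  have hN : v 0 ^ 2 + v 1 ^ 2 + v 2 ^ 2 = ‖v‖ ^ 2 := by
    rw [EuclideanSpace.norm_sq_eq]
    simp [Fin.sum_univ_three]
  have hN0 : ‖v‖ ^ 2 ≠ 0 := pow_ne_zero _ (norm_ne_zero_iff.2 hv)
  -- The reflected point is X - kv. Clearing the denominator of k turns the claims below into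
  -- polynomial identities modulo `hk` and the sphere equation.
  obtain ⟨k, hk, hY⟩ : ∃ k : ℝ, k * (v 0 ^ 2 + v 1 ^ 2 + v 2 ^ 2)
      = 2 * (v 0 * X.1 0 + v 1 * X.1 1 + v 2 * X.1 2) ∧
      ∀ i, (spherePerm (Submodule.reflection (ℝ ∙ v)ᗮ) X).1 i = X.1 i - k * v i := by
    refine ⟨2 * (inner ℝ v X.1 / ‖v‖ ^ 2), ?_, fun i => ?_⟩
    · rw [hN, mul_assoc, div_mul_cancel₀ _ hN0]
      congr 1
      simp [PiLp.inner_apply, Fin.sum_univ_three]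
      ring
    · rw [coe_spherePerm, Submodule.reflection_orthogonal_apply,
        Submodule.reflection_singleton_apply]
      simp
      ring
  have hdet : (reflMatrix v hv) 0 0 * (reflMatrix v hv) 1 1
      - (reflMatrix v hv) 0 1 * (reflMatrix v hv) 1 0 ≠ 0 := by
    rw [← det_fin_two]
    exact (reflMatrix v hv).det_ne_zero
  have a00 : (reflMatrix v hv) 0 0 = -(v 0 + v 1 * Complex.I) := rfl
  have a01 : (reflMatrix v hv) 0 1 = v 2 := rfl
  have a10 : (reflMatrix v hv) 1 0 = v 2 := rfl
  have a11 : (reflMatrix v hv) 1 1 = v 0 - v 1 * Complex.I := rfl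
  have hk' : (k * (v 0 ^ 2 + v 1 ^ 2 + v 2 ^ 2)
      - 2 * (v 0 * X.1 0 + v 1 * X.1 1 + v 2 * X.1 2) : ℂ) = 0 := by
    rw [← sub_eq_zero] at hk
    exact_mod_cast congrArg Complex.ofReal hk
  have hs' : (X.1 0 ^ 2 + X.1 1 ^ 2 + X.1 2 ^ 2 : ℂ) = 1 := by
    have h := congrArg Complex.ofReal hs
    push_cast at h
    exact h
  have hI := Complex.I_sq
  by_cases hX : X.1 2 = 1
  · have e0 : X.1 0 = 0 := by nlinarith [sq_nonneg (X.1 0), sq_nonneg (X.1 1)]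
    have e1 : X.1 1 = 0 := by nlinarith [sq_nonneg (X.1 0), sq_nonneg (X.1 1)]
    have : stereo X = ∞ := by simp [stereo, hX]
    rw [this, OnePoint.map_infty, smul_infty_eq_ite]
    rw [hX, e0, e1] at hk'
    push_cast at hk'
    apply stereo_eq_ite
    · by_contra! h
      apply hdet
      rw [h.1, h.2]
      ring
    · rw [hY, hY, hY, a00, a10, hX, e0, e1]
      push_cast
      ring
    · rw [hY, hY, hY, a00, a10, hX, e0, e1]
      push_cast
      linear_combination hk' - k * v 1 ^ 2 * hI
  · have hX' : (1 - X.1 2 : ℂ) ≠ 0 := by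
      intro e
      apply hX
      have : ((1 - X.1 2 : ℝ) : ℂ) = 0 := by push_cast; exact e
      have := Complex.ofReal_eq_zero.1 this
      linarith
    obtain ⟨w, hw, hXw⟩ : ∃ w : ℂ, w * (1 - X.1 2) = X.1 0 - X.1 1 * Complex.I ∧
        OnePoint.map conj (stereo X) = (w : CHat) := by
      refine ⟨conj (⟨X.1 0 / (1 - X.1 2), X.1 1 / (1 - X.1 2)⟩ : ℂ), ?_, ?_⟩
      · rw [Complex.mk_eq_add_mul_I]
        simp only [map_add, map_mul, Complex.conj_ofReal, Complex.conj_I]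
        push_cast
        field_simp
        ring
      · simp [stereo, hX]
    rw [hXw, smul_some_eq_ite]
    apply stereo_eq_ite
    · by_contra! h
      obtain ⟨h1, h2⟩ := h
      have h3 : (reflMatrix v hv) 0 0 ≠ 0 ∨ (reflMatrix v hv) 1 0 ≠ 0 := by
        by_contra! h
        apply hdet
        rw [h.1, h.2]
        ring
      rcases h3 with h3 | h3
      · apply hdet
        linear_combination (reflMatrix v hv) 0 0 * h2 - (reflMatrix v hv) 1 0 * h1
      · apply hdet
        linear_combination (reflMatrix v hv) 0 0 * h2 - (reflMatrix v hv) 1 0 * h1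
    · rw [hY, hY, hY, a00, a01, a10, a11]
      apply mul_left_cancel₀ hX'
      push_cast
      linear_combination (-(v 0 + v 1 * Complex.I) * (1 - X.1 2 + k * v 2) - v 2 * ((X.1 0 + X.1 1 * Complex.I) - k * (v 0 + v 1 * Complex.I))) * hw
        + (1 - X.1 2) * hk' - v 2 * hs'
        + (v 2 * X.1 1 ^ 2 - k * v 1 ^ 2 * (1 - X.1 2) + 2 * (1 - X.1 2) * v 1 * X.1 1) * hI
    · rw [hY, hY, hY, a00, a01, a10, a11]
      apply mul_left_cancel₀ hX'
      push_cast
      linear_combination (-(v 0 + v 1 * Complex.I) * ((X.1 0 - X.1 1 * Complex.I) - k * (v 0 - v 1 * Complex.I)) - v 2 * (1 + X.1 2 - k * v 2)) * hw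
        + (X.1 0 - X.1 1 * Complex.I) * hk' + (v 0 - v 1 * Complex.I) * hs'
        + (-(v 0 - v 1 * Complex.I) * X.1 1 ^ 2 - k * v 1 ^ 2 * (X.1 0 - X.1 1 * Complex.I) + 2 * (X.1 0 - X.1 1 * Complex.I) * v 1 * X.1 1) * hI

/-- Linear isometries act on the extended complex plane by linear fractional transformations,
composed with complex conjugation if they reverse the orientation. -/
theorem stereo_isometry (R : E3 ≃ₗᵢ[ℝ] E3) :
    (isomDet R = 1 ∧ ∃ A : GL (Fin 2) ℂ, ∀ X, stereo (spherePerm R X) = A • stereo X) ∨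
    (isomDet R = -1 ∧ ∃ A : GL (Fin 2) ℂ, ∀ X,
      stereo (spherePerm R X) = A • OnePoint.map conj (stereo X)) := by
  -- Each reflection in a product of reflections changes the sign of the determinant and contributes
  -- one complex conjugation; two conjugations cancel once the first is moved past a matrix by
  -- conjugating its entries.
  obtain ⟨l, -, rfl⟩ := R.reflections_generate_dim
  induction l with
  | nil => exact Or.inl ⟨isomDet_one, 1, fun X => by simp⟩
  | cons v l ih =>
    rw [List.map_cons, List.prod_cons]
    -- The zero vector may occur in the list; its reflection is the identity.
    by_cases hv : v = 0
    · have : Submodule.reflection (ℝ ∙ v)ᗮ = 1 := by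
        ext x
        rw [hv, Submodule.reflection_orthogonal_apply, Submodule.reflection_singleton_apply]
        simp
      rwa [this, one_mul]
    · have hdet : isomDet (Submodule.reflection (ℝ ∙ v)ᗮ) = -1 := by
        have h := Submodule.det_reflection (𝕜 := ℝ) (K := (ℝ ∙ v)ᗮ)
        rw [Submodule.orthogonal_orthogonal, finrank_span_singleton hv, pow_one] at h
        exact h
      rw [isomDet_mul, hdet, map_mul]
      rcases ih with ⟨h, A, hA⟩ | ⟨h, A, hA⟩
      · refine Or.inr ⟨by rw [h]; norm_num, reflMatrix v hv * A.map (starRingEnd ℂ), fun X => ?_⟩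
        rw [Equiv.Perm.mul_apply, stereo_reflection v hv, hA, mul_smul, OnePoint.map_smul]
      · refine Or.inl ⟨by rw [h]; norm_num, reflMatrix v hv * A.map (starRingEnd ℂ), fun X => ?_⟩
        rw [Equiv.Perm.mul_apply, stereo_reflection v hv, hA, mul_smul, OnePoint.map_smul]
        congr 2
        induction stereo X using OnePoint.rec <;> simp

theorem spherePerm_mem_sphereMoebius {R : E3 ≃ₗᵢ[ℝ] E3} (hR : isomDet R = 1) :
    spherePerm R ∈ sphereMoebius := by
  rcases stereo_isometry R with ⟨-, A, hA⟩ | ⟨h, -⟩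
  · refine mem_sphereMoebius.2 ⟨A, Equiv.ext fun x => ?_⟩
    have := hA (stereo.symm x)
    rw [Equiv.apply_symm_apply] at this
    simpa using this.symm
  · rw [hR] at h
    norm_num at h

end Rotations

/-! ### An integer matrix model of the octahedral group -/

section Matrices

open Matrix

/-- Half-diagonals of the cube, one for each of the four diagonals, with sum zero. -/
def cubeDiagonal : Matrix (Fin 4) (Fin 3) ℤ :=
  !![1, 1, 1; 1, -1, -1; -1, 1, -1; -1, -1, 1]

/-- The matrix of the rotation of the cube that permutes the four diagonals by `π`. -/
def octMatrix (π : Equiv.Perm (Fin 4)) : Matrix (Fin 3) (Fin 3) ℤ := fun j k =>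
  -- The diagonals satisfy dᵢ · dₖ = 4δᵢₖ - 1 and have sum zero, so the matrix sends dₖ to sign(π)
  -- d_{π k}. The sign makes the determinant 1, and the division by 4 is exact.
  (Equiv.Perm.sign π : ℤ) * (∑ i, cubeDiagonal (π i) j * cubeDiagonal i k) / 4

theorem octMatrix_one : octMatrix 1 = 1 := by decide +kernel

theorem octMatrix_mul : ∀ π τ : Equiv.Perm (Fin 4),
    octMatrix (π * τ) = octMatrix π * octMatrix τ := by decide +kernel

theorem octMatrix_transpose_mul : ∀ π : Equiv.Perm (Fin 4),
    (octMatrix π)ᵀ * octMatrix π = 1 := by decide +kernel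

theorem octMatrix_det : ∀ π : Equiv.Perm (Fin 4), (octMatrix π).det = 1 := by decide +kernel

theorem octMatrix_injective : ∀ π : Equiv.Perm (Fin 4), octMatrix π = 1 → π = 1 := by
  decide +kernel

/-- Matrices of determinant one that take basis vectors to basis vectors up to sign are matrices
of rotations of the cube. -/
theorem exists_octMatrix_eq : ∀ (σ : Fin 3 → Fin 3) (ε : Fin 3 → ℤˣ),
    (Matrix.of fun j k => if j = σ k then (ε k : ℤ) else 0).det = 1 →
      ∃ π, octMatrix π = Matrix.of fun j k => if j = σ k then (ε k : ℤ) else 0 := by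
  decide +kernel

/-- Integer vectors in the directions of the vertices of the cube. -/
def vertexVectors : Finset (Fin 3 → ℤ) :=
  Finset.univ.image fun ε : Fin 3 → ℤˣ => fun i => (ε i : ℤ)

/-- Integer vectors in the directions of the centres of the faces of the cube. -/
def faceVectors : Finset (Fin 3 → ℤ) :=
  Finset.univ.image fun p : Fin 3 × ℤˣ => fun j => if j = p.1 then (p.2 : ℤ) else 0

/-- Integer vectors in the directions of the midpoints of the edges of the cube. -/
def edgeVectors : Finset (Fin 3 → ℤ) :=
  Finset.univ.image fun p : (Fin 3 → ℤˣ) × Fin 3 => fun j => if j = p.2 then 0 else (p.1 j : ℤ)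

theorem card_vertexVectors : vertexVectors.card = 8 := by decide +kernel
theorem card_faceVectors : faceVectors.card = 6 := by decide +kernel
theorem card_edgeVectors : edgeVectors.card = 12 := by decide +kernel

theorem vertexVectors_norm : ∀ u ∈ vertexVectors, u 0 ^ 2 + u 1 ^ 2 + u 2 ^ 2 = 3 := by
  decide +kernel
theorem faceVectors_norm : ∀ u ∈ faceVectors, u 0 ^ 2 + u 1 ^ 2 + u 2 ^ 2 = 1 := by
  decide +kernel
theorem edgeVectors_norm : ∀ u ∈ edgeVectors, u 0 ^ 2 + u 1 ^ 2 + u 2 ^ 2 = 2 := by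
  decide +kernel

theorem vertexVectors_neg : ∀ u ∈ vertexVectors, -u ∈ vertexVectors := by decide +kernel
theorem faceVectors_neg : ∀ u ∈ faceVectors, -u ∈ faceVectors := by decide +kernel
theorem edgeVectors_neg : ∀ u ∈ edgeVectors, -u ∈ edgeVectors := by decide +kernel

theorem vertexVectors_transitive : ∀ u ∈ vertexVectors,
    Finset.univ.image (fun π => octMatrix π *ᵥ u) = vertexVectors := by decide +kernel
theorem faceVectors_transitive : ∀ u ∈ faceVectors,
    Finset.univ.image (fun π => octMatrix π *ᵥ u) = faceVectors := by decide +kernel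
theorem edgeVectors_transitive : ∀ u ∈ edgeVectors,
    Finset.univ.image (fun π => octMatrix π *ᵥ u) = edgeVectors := by decide +kernel

theorem octMatrix_trace : ∀ π, π ≠ 1 → (octMatrix π).trace ≠ 3 := by decide +kernel

/-- The symmetric part of a rotation matrix in terms of the axis of the rotation. -/
theorem octMatrix_axis : ∀ π, π ≠ 1 →
    ∃ u ∈ vertexVectors ∪ faceVectors ∪ edgeVectors, ∀ i j,
      (u 0 ^ 2 + u 1 ^ 2 + u 2 ^ 2) * (octMatrix π i j + octMatrix π j i) =
        (u 0 ^ 2 + u 1 ^ 2 + u 2 ^ 2) * ((octMatrix π).trace - 1) * (1 : Matrix _ _ ℤ) i j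
        + (3 - (octMatrix π).trace) * u i * u j := by decide +kernel

end Matrices

/-! ### Rotations of the cube in the coordinates of `b` -/

section Cube

open Matrix

variable (b : OrthonormalBasis (Fin 3) ℝ E3)

theorem ext_repr {x y : E3} (h : ∀ i, b.repr x i = b.repr y i) : x = y :=
  b.repr.injective (by ext i; exact h i)

theorem norm_sq_eq_repr (x : E3) :
    ‖x‖ ^ 2 = b.repr x 0 ^ 2 + b.repr x 1 ^ 2 + b.repr x 2 ^ 2 := by
  rw [← b.repr.norm_map, EuclideanSpace.norm_sq_eq]
  simp [Fin.sum_univ_three]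

theorem repr_toLin (A : Matrix (Fin 3) (Fin 3) ℝ) (x : E3) (i : Fin 3) :
    b.repr (Matrix.toLin b.toBasis b.toBasis A x) i = ∑ j, A i j * b.repr x j := by
  have h := LinearMap.toMatrix_mulVec_repr b.toBasis b.toBasis
    (Matrix.toLin b.toBasis b.toBasis A) x
  rw [LinearMap.toMatrix_toLin] at h
  have := congrFun h i
  simpa [Matrix.mulVec, dotProduct] using this.symm

/-- The rotation of the cube that permutes its four diagonals by `π`. -/
def octRotation (π : Equiv.Perm (Fin 4)) : E3 ≃ₗᵢ[ℝ] E3 :=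
  ((Matrix.toLin b.toBasis b.toBasis ((octMatrix π).map (Int.castRingHom ℝ))).isometryOfInner
    (fun x y => by
      have h : ((octMatrix π).map (Int.castRingHom ℝ))ᵀ * (octMatrix π).map (Int.castRingHom ℝ)
          = 1 := by
        rw [← Matrix.transpose_map, ← Matrix.map_mul, octMatrix_transpose_mul]
        simp
      have hx : ∀ x : E3, (b.repr (Matrix.toLin b.toBasis b.toBasis
          ((octMatrix π).map (Int.castRingHom ℝ)) x)).ofLp
          = (octMatrix π).map (Int.castRingHom ℝ) *ᵥ (b.repr x).ofLp := fun x => by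
        funext i
        rw [repr_toLin]
        rfl
      rw [← b.repr.inner_map_map, ← b.repr.inner_map_map x y, EuclideanSpace.inner_eq_star_dotProduct,
        EuclideanSpace.inner_eq_star_dotProduct, hx, hx, star_trivial, star_trivial,
        Matrix.dotProduct_mulVec, Matrix.vecMul_mulVec, h, Matrix.vecMul_one])).toLinearIsometryEquiv
    rfl

theorem repr_octRotation (π : Equiv.Perm (Fin 4)) (x : E3) (i : Fin 3) :
    b.repr (octRotation b π x) i = ∑ j, (octMatrix π i j : ℝ) * b.repr x j :=
  repr_toLin b _ x i

theorem isomDet_octRotation (π : Equiv.Perm (Fin 4)) : isomDet (octRotation b π) = 1 := by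
  have : ((octRotation b π).toLinearEquiv : E3 →ₗ[ℝ] E3)
      = Matrix.toLin b.toBasis b.toBasis ((octMatrix π).map (Int.castRingHom ℝ)) := rfl
  rw [isomDet, this, LinearMap.det_toLin]
  have h := RingHom.map_det (Int.castRingHom ℝ) (octMatrix π)
  rw [octMatrix_det, map_one] at h
  exact h.symm

/-- The action of the symmetric group on the sphere by rotations of the cube. -/
def octHom : Equiv.Perm (Fin 4) →* Equiv.Perm S2 where
  toFun π := spherePerm (octRotation b π)
  map_one' := by
    rw [← map_one spherePerm]
    congr 1
    ext1 x
    apply ext_repr b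
    intro i
    rw [repr_octRotation, octMatrix_one]
    simp [Matrix.one_apply]
  map_mul' π τ := by
    rw [← map_mul spherePerm]
    congr 1
    ext1 x
    apply ext_repr b
    intro i
    change _ = b.repr (octRotation b π (octRotation b τ x)) i
    rw [repr_octRotation, octMatrix_mul, repr_octRotation]
    simp only [repr_octRotation, Matrix.mul_apply, Fin.sum_univ_three]
    push_cast
    ring

theorem octHom_apply (π : Equiv.Perm (Fin 4)) (X : S2) :
    (octHom b π X : E3) = octRotation b π X := rfl

theorem octHom_injective : Function.Injective (octHom b) := by
  rw [injective_iff_map_eq_one]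
  intro π h
  apply octMatrix_injective
  ext i j
  have hX : b j ∈ Metric.sphere (0 : E3) 1 := by simp
  have h1 := congrArg (fun x : E3 => b.repr x i)
    (congrArg Subtype.val (DFunLike.congr_fun h (⟨b j, hX⟩ : S2)))
  simp only [octHom_apply, repr_octRotation, Equiv.Perm.one_apply, OrthonormalBasis.repr_self] at h1
  simp only [PiLp.single_apply, mul_ite, mul_one, mul_zero, Finset.sum_ite_eq',
    Finset.mem_univ, if_true] at h1
  rw [Matrix.one_apply]
  split_ifs at h1 ⊢ with e <;> exact_mod_cast h1

theorem repr_cubeVertex (ε : Fin 3 → ℤˣ) (i : Fin 3) :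
    b.repr (cubeVertex b ε) i = ((ε i : ℤ) : ℝ) / √3 := by
  simp only [cubeVertex, map_smul, map_sum, OrthonormalBasis.repr_self, PiLp.smul_apply,
    WithLp.ofLp_sum, Finset.sum_apply, PiLp.single_apply, smul_eq_mul, mul_ite, mul_one, mul_zero,
    Finset.sum_ite_eq, Finset.mem_univ, if_true]
  ring

theorem units_cast_sq (s : ℤˣ) : ((s : ℤ) : ℝ) ^ 2 = 1 := by
  rcases Int.units_eq_one_or s with rfl | rfl <;> simp

theorem norm_cubeVertex (ε : Fin 3 → ℤˣ) : ‖cubeVertex b ε‖ = 1 := by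
  have h := norm_sq_eq_repr b (cubeVertex b ε)
  simp only [repr_cubeVertex, div_pow, units_cast_sq] at h
  rw [Real.sq_sqrt (by norm_num)] at h
  have := norm_nonneg (cubeVertex b ε)
  nlinarith

/-- The vertices lie on the unit sphere, whose points are extreme in the closed ball by strict
convexity, and the ball contains the cube. Thus an isometry preserving the solid cube permutes its
vertices. -/
theorem extremePoints_cube : (cube b).extremePoints ℝ = Set.range (cubeVertex b) := by
  apply Set.Subset.antisymm extremePoints_convexHull_subset
  have hsub : Set.range (cubeVertex b) ⊆ Metric.sphere 0 1 := by
    rintro _ ⟨ε, rfl⟩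
    simp [norm_cubeVertex]
  have hball : cube b ⊆ Metric.closedBall 0 1 :=
    convexHull_min (hsub.trans Metric.sphere_subset_closedBall) (convex_closedBall _ _)
  intro x hx
  exact inter_extremePoints_subset_extremePoints_of_subset hball
    ⟨subset_convexHull ℝ _ hx,
      StrictConvexSpace.sphere_subset_extremePoints_closedBall 0 one_ne_zero (hsub hx)⟩

theorem image_cube_eq_iff (R : E3 ≃ₗᵢ[ℝ] E3) :
    R '' cube b = cube b ↔ R '' Set.range (cubeVertex b) = Set.range (cubeVertex b) := by
  constructor
  · intro h
    rw [← extremePoints_cube]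
    conv_rhs => rw [← h]
    exact image_extremePoints R.toLinearEquiv _
  · intro h
    conv_rhs => rw [cube, ← h]
    exact (R.toLinearEquiv : E3 →ₗ[ℝ] E3).image_convexHull _

theorem octRotation_image_cube (π : Equiv.Perm (Fin 4)) : octRotation b π '' cube b = cube b := by
  rw [image_cube_eq_iff]
  have h : ∀ ε : Fin 3 → ℤˣ, ∃ ε', octRotation b π (cubeVertex b ε) = cubeVertex b ε' := by
    intro ε
    have hu : (fun i => (ε i : ℤ)) ∈ vertexVectors := Finset.mem_image_of_mem _ (Finset.mem_univ ε)
    have h2 := Finset.mem_image_of_mem (fun π => octMatrix π *ᵥ (fun i => (ε i : ℤ)))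
      (Finset.mem_univ π)
    rw [vertexVectors_transitive _ hu] at h2
    obtain ⟨ε', -, he⟩ := Finset.mem_image.1 h2
    refine ⟨ε', ext_repr b fun i => ?_⟩
    rw [repr_octRotation, repr_cubeVertex]
    simp only [repr_cubeVertex]
    have := congrFun he i
    simp only [Matrix.mulVec, dotProduct] at this
    rw [this]
    push_cast
    rw [Finset.sum_div]
    exact Finset.sum_congr rfl fun j _ => by ring
  have hsub : octRotation b π '' Set.range (cubeVertex b) ⊆ Set.range (cubeVertex b) := by
    rintro _ ⟨_, ⟨ε, rfl⟩, rfl⟩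
    obtain ⟨ε', he⟩ := h ε
    exact ⟨ε', he.symm⟩
  apply Set.eq_of_subset_of_ncard_le hsub _ (Set.finite_range _)
  rw [Set.ncard_image_of_injective _ (octRotation b π).injective]

theorem units_sub_eq_single : ∀ ε ε' : Fin 3 → ℤˣ,
    ((ε 0 : ℤ) - ε' 0) ^ 2 + ((ε 1 : ℤ) - ε' 1) ^ 2 + ((ε 2 : ℤ) - ε' 2) ^ 2 = 4 →
      ∃ (i : Fin 3) (s : ℤˣ), ∀ j, (ε j : ℤ) - ε' j = 2 * if j = i then (s : ℤ) else 0 := by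
  decide +kernel

theorem sub_cubeVertex_update (k : Fin 3) :
    cubeVertex b 1 - cubeVertex b (Function.update 1 k (-1)) = (2 / √3 : ℝ) • b k := by
  apply ext_repr b
  intro i
  simp only [map_sub, map_smul, PiLp.sub_apply, PiLp.smul_apply, repr_cubeVertex,
    OrthonormalBasis.repr_self, PiLp.single_apply, Function.update_apply]
  split_ifs with h
  · simp
    ring
  · simp

/-- An edge vector (2/√3) `b k` is a difference of vertices, and so is its image. In units of 1/√3
the image has entries 0 or ±2 and squared length 4, so a single entry survives: the matrix of R is a
signed permutation matrix. -/
theorem exists_repr_eq_of_image_cube {R : E3 ≃ₗᵢ[ℝ] E3} (hR : R '' cube b = cube b) (k : Fin 3) :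
    ∃ (i : Fin 3) (s : ℤˣ), ∀ j, b.repr (R (b k)) j = ((if j = i then (s : ℤ) else 0 : ℤ) : ℝ) := by
  rw [image_cube_eq_iff] at hR
  have h3 : √(3 : ℝ) ≠ 0 := by positivity
  have hv : ∀ ε, ∃ ε', cubeVertex b ε' = R (cubeVertex b ε) := fun ε => by
    have : R (cubeVertex b ε) ∈ R '' Set.range (cubeVertex b) :=
      Set.mem_image_of_mem _ (Set.mem_range_self _)
    rwa [hR] at this
  obtain ⟨ε, hε⟩ := hv 1
  obtain ⟨ε', hε'⟩ := hv (Function.update 1 k (-1))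
  have h := congrArg R (sub_cubeVertex_update b k)
  rw [map_sub, ← hε, ← hε', map_smul] at h
  have hc : ∀ j, ((ε j : ℤ) : ℝ) - (ε' j : ℤ) = 2 * b.repr (R (b k)) j := fun j => by
    have := congrArg (fun x : E3 => b.repr x j) h
    simp only [map_sub, map_smul, PiLp.sub_apply, PiLp.smul_apply, repr_cubeVertex,
      smul_eq_mul] at this
    field_simp at this
    exact this
  have hn := norm_sq_eq_repr b (R (b k))
  rw [R.norm_map, b.norm_eq_one] at hn
  obtain ⟨i, s, his⟩ := units_sub_eq_single ε ε' (by
    have : (((ε 0 : ℤ) : ℝ) - (ε' 0 : ℤ)) ^ 2 + (((ε 1 : ℤ) : ℝ) - (ε' 1 : ℤ)) ^ 2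
        + (((ε 2 : ℤ) : ℝ) - (ε' 2 : ℤ)) ^ 2 = 4 := by
      rw [hc, hc, hc]
      linear_combination -4 * hn
    exact_mod_cast this)
  refine ⟨i, s, fun j => ?_⟩
  have h1 := hc j
  have h2 : ((ε j : ℤ) : ℝ) - (ε' j : ℤ) = 2 * ((if j = i then (s : ℤ) else 0 : ℤ) : ℝ) := by
    exact_mod_cast his j
  linarith

theorem exists_octRotation_eq {R : E3 ≃ₗᵢ[ℝ] E3} (hR : R '' cube b = cube b)
    (hdet : isomDet R = 1) : ∃ π, octRotation b π = R := by
  choose σ ε h using exists_repr_eq_of_image_cube b hR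
  set A : Matrix (Fin 3) (Fin 3) ℤ := Matrix.of fun j k => if j = σ k then (ε k : ℤ) else 0 with hA
  have hRA : LinearMap.toMatrix b.toBasis b.toBasis (R.toLinearEquiv : E3 →ₗ[ℝ] E3)
      = A.map (Int.castRingHom ℝ) := by
    ext j k
    rw [LinearMap.toMatrix_apply]
    simpa [hA] using h k j
  have hd : A.det = 1 := by
    rw [isomDet, ← LinearMap.det_toMatrix b.toBasis, hRA] at hdet
    have h1 := RingHom.map_det (Int.castRingHom ℝ) A
    rw [RingHom.mapMatrix_apply, hdet] at h1
    simpa using h1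
  obtain ⟨π, hπ⟩ := exists_octMatrix_eq σ ε hd
  refine ⟨π, ?_⟩
  have : ((octRotation b π).toLinearEquiv : E3 →ₗ[ℝ] E3) = R.toLinearEquiv := by
    apply (LinearMap.toMatrix b.toBasis b.toBasis).injective
    rw [hRA]
    have : ((octRotation b π).toLinearEquiv : E3 →ₗ[ℝ] E3)
      = Matrix.toLin b.toBasis b.toBasis ((octMatrix π).map (Int.castRingHom ℝ)) := rfl
    rw [this, LinearMap.toMatrix_toLin, hπ]
  ext1 x
  exact LinearMap.congr_fun this x

theorem octHom_range : (octHom b).range = octahedralGroup b := by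
  ext g
  constructor
  · rintro ⟨π, rfl⟩
    exact ⟨octRotation b π, isomDet_octRotation b π, octRotation_image_cube b π, fun _ => rfl⟩
  · rintro ⟨R, hdet, hR, hg⟩
    obtain ⟨π, rfl⟩ := exists_octRotation_eq b hR hdet
    exact ⟨π, Equiv.ext fun X => Subtype.ext (hg X).symm⟩

theorem octahedralGroup_le_sphereMoebius : octahedralGroup b ≤ sphereMoebius := by
  rw [← octHom_range]
  rintro _ ⟨π, rfl⟩
  exact spherePerm_mem_sphereMoebius (isomDet_octRotation b π)

/-- The octahedral group is isomorphic to the symmetric group of the diagonals of the cube. -/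
def octahedralGroupEquiv : octahedralGroup b ≃* Equiv.Perm (Fin 4) :=
  ((MonoidHom.ofInjective (octHom_injective b)).trans
    (MulEquiv.subgroupCongr (octHom_range b))).symm

theorem card_octahedralGroup : Nat.card (octahedralGroup b) = 24 := by
  rw [Nat.card_congr (octahedralGroupEquiv b).toEquiv, Nat.card_eq_fintype_card,
    Fintype.card_perm, Fintype.card_fin]
  rfl

instance : Finite (octahedralGroup b) :=
  Finite.of_equiv _ (octahedralGroupEquiv b).symm.toEquiv

theorem mem_orbit_octahedralGroup {X Y : S2} :
    Y ∈ MulAction.orbit (octahedralGroup b) X ↔ ∃ π, octHom b π X = Y := by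
  constructor
  · rintro ⟨⟨g, hg⟩, rfl⟩
    rw [← octHom_range] at hg
    obtain ⟨π, rfl⟩ := hg
    exact ⟨π, rfl⟩
  · rintro ⟨π, rfl⟩
    exact ⟨⟨octHom b π, by rw [← octHom_range]; exact ⟨π, rfl⟩⟩, rfl⟩

/-! ### The exceptional orbits and the rotation axes -/

/-- The points of the sphere in the directions of the vectors of `U`, all of square norm `n`. -/
def directionSet (U : Finset (Fin 3 → ℤ)) (n : ℕ) : Set S2 :=
  {X | ∃ u ∈ U, ∀ i, b.repr X.1 i = u i / √n}

theorem ncard_directionSet {U : Finset (Fin 3 → ℤ)} {n : ℕ} (hn : n ≠ 0)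
    (hU : ∀ u ∈ U, u 0 ^ 2 + u 1 ^ 2 + u 2 ^ 2 = n) : (directionSet b U n).ncard = U.card := by
  have hn' : (0 : ℝ) < n := by positivity
  have hs : √(n : ℝ) ≠ 0 := by positivity
  rw [← Set.ncard_coe_finset]
  symm
  have hrepr : ∀ (u : Fin 3 → ℤ) i,
      b.repr (b.repr.symm (WithLp.toLp 2 fun i => (u i : ℝ) / √n)) i = u i / √n := fun u i => by
    rw [LinearIsometryEquiv.apply_symm_apply]
  refine Set.ncard_congr (fun u hu => (⟨b.repr.symm (WithLp.toLp 2 fun i => (u i : ℝ) / √n), ?_⟩ : S2))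
    ?_ ?_ ?_
  · rw [mem_sphere_zero_iff_norm]
    have h := norm_sq_eq_repr b (b.repr.symm (WithLp.toLp 2 fun i => (u i : ℝ) / √n))
    have h2 : (u 0 ^ 2 + u 1 ^ 2 + u 2 ^ 2 : ℝ) = n := by exact_mod_cast hU u hu
    rw [hrepr, hrepr, hrepr, div_pow, div_pow, div_pow, ← add_div, ← add_div, h2,
      Real.sq_sqrt hn'.le, div_self hn'.ne'] at h
    exact (pow_eq_one_iff_of_nonneg (norm_nonneg _) two_ne_zero).1 h
  · exact fun u hu => ⟨u, hu, hrepr u⟩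
  · intro u u' hu hu' h
    funext i
    have := congrArg (fun x : E3 => b.repr x i) (congrArg Subtype.val h)
    simp only [hrepr] at this
    rw [div_left_inj' hs] at this
    exact_mod_cast this
  · rintro X ⟨u, hu, h⟩
    refine ⟨u, hu, Subtype.ext (ext_repr b fun i => ?_)⟩
    rw [hrepr, h]

/-- The matrices act linearly, so the factor 1/√n passes through and transitivity on the integer
vectors carries over to the sphere. -/
theorem orbit_eq_directionSet {U : Finset (Fin 3 → ℤ)} {n : ℕ}
    (hU : ∀ u ∈ U, Finset.univ.image (fun π => octMatrix π *ᵥ u) = U) {X : S2}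
    (hX : X ∈ directionSet b U n) :
    MulAction.orbit (octahedralGroup b) X = directionSet b U n := by
  obtain ⟨u, hu, h⟩ := hX
  have hπ : ∀ π i, b.repr (octHom b π X).1 i = ((octMatrix π *ᵥ u) i : ℝ) / √n := fun π i => by
    rw [octHom_apply, repr_octRotation]
    simp only [h, Matrix.mulVec, dotProduct]
    push_cast
    rw [Finset.sum_div]
    exact Finset.sum_congr rfl fun j _ => by ring
  ext Y
  rw [mem_orbit_octahedralGroup]
  constructor
  · rintro ⟨π, rfl⟩
    refine ⟨octMatrix π *ᵥ u, ?_, hπ π⟩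
    rw [← hU u hu]
    exact Finset.mem_image_of_mem _ (Finset.mem_univ π)
  · rintro ⟨u', hu', h'⟩
    rw [← hU u hu] at hu'
    obtain ⟨π, -, rfl⟩ := Finset.mem_image.1 hu'
    refine ⟨π, Subtype.ext (ext_repr b fun i => ?_)⟩
    rw [hπ, h']

theorem VO_eq : VO b = directionSet b vertexVectors 3 := by
  ext X
  constructor
  · rintro ⟨ε, h⟩
    refine ⟨_, Finset.mem_image_of_mem _ (Finset.mem_univ ε), fun i => ?_⟩
    rw [h, repr_cubeVertex]
    simp
  · rintro ⟨u, hu, h⟩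
    obtain ⟨ε, -, rfl⟩ := Finset.mem_image.1 hu
    refine ⟨ε, ext_repr b fun i => ?_⟩
    rw [h, repr_cubeVertex]
    simp

theorem repr_radial {x : E3} {c : ℝ} (hc : 0 < c) {u : Fin 3 → ℤ} {n : ℕ}
    (hu : u 0 ^ 2 + u 1 ^ 2 + u 2 ^ 2 = n) (h : ∀ i, b.repr x i = c * u i) (i : Fin 3) :
    b.repr (radial x) i = u i / √n := by
  have hx : ‖x‖ = c * √n := by
    have h1 := norm_sq_eq_repr b x
    have h2 : (u 0 ^ 2 + u 1 ^ 2 + u 2 ^ 2 : ℝ) = n := by exact_mod_cast hu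
    rw [h, h, h, mul_pow, mul_pow, mul_pow, ← mul_add, ← mul_add, h2] at h1
    rw [← Real.sqrt_sq (norm_nonneg x), h1, Real.sqrt_mul (sq_nonneg c), Real.sqrt_sq hc.le]
  simp only [radial, map_smul, PiLp.smul_apply, smul_eq_mul, hx, h]
  rw [mul_inv, mul_comm c⁻¹, mul_assoc, inv_mul_cancel_left₀ hc.ne', div_eq_inv_mul]

theorem sum_units_filter : ∀ (i j : Fin 3) (s : ℤˣ),
    (∑ ε ∈ Finset.univ.filter (fun ε : Fin 3 → ℤˣ => ε i = s), (ε j : ℤ))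
      = 4 * if j = i then (s : ℤ) else 0 := by decide +kernel

theorem card_units_filter : ∀ (i : Fin 3) (s : ℤˣ),
    (Finset.univ.filter (fun ε : Fin 3 → ℤˣ => ε i = s)).card = 4 := by decide +kernel

theorem repr_faceCenter (i : Fin 3) (s : ℤˣ) (j : Fin 3) :
    b.repr (faceCenter b i s) j = (1 / √3) * ((if j = i then (s : ℤ) else 0 : ℤ) : ℝ) := by
  have hne : (Finset.univ.filter (fun ε : Fin 3 → ℤˣ => ε i = s)).Nonempty := by
    rw [← Finset.card_pos, card_units_filter]
    norm_num
  have h : faceCenter b i s = (1 / 4 : ℝ) •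
      ∑ ε ∈ Finset.univ.filter (fun ε : Fin 3 → ℤˣ => ε i = s), cubeVertex b ε := by
    rw [faceCenter, Finset.centroid_eq_centerMass _ hne, Finset.centerMass]
    rw [Finset.sum_centroidWeights_eq_one_of_nonempty ℝ _ hne]
    simp [Finset.centroidWeights, card_units_filter, Finset.smul_sum]
  have h2 := congrArg (Int.cast : ℤ → ℝ) (sum_units_filter i j s)
  push_cast at h2
  rw [h, map_smul, map_sum, PiLp.smul_apply, WithLp.ofLp_sum, Finset.sum_apply]
  simp only [repr_cubeVertex]
  rw [← Finset.sum_div, h2, smul_eq_mul]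
  push_cast
  ring

theorem repr_edgeMidpoint (ε : Fin 3 → ℤˣ) (i j : Fin 3) :
    b.repr (edgeMidpoint b ε i) j = (1 / √3) * ((if j = i then 0 else (ε j : ℤ) : ℤ) : ℝ) := by
  rw [edgeMidpoint, midpoint_eq_smul_add, map_smul, map_add, PiLp.smul_apply, PiLp.add_apply,
    repr_cubeVertex, repr_cubeVertex, Function.update_apply]
  split_ifs with h
  · subst h
    simp
    ring
  · simp
    ring

theorem FO_eq : FO b = directionSet b faceVectors 1 := by
  have key : ∀ i s j, b.repr (radial (faceCenter b i s)) j
      = ((if j = i then (s : ℤ) else 0 : ℤ) : ℝ) / √(1 : ℕ) := fun i s =>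
    repr_radial b (by positivity) (faceVectors_norm _
      (Finset.mem_image_of_mem _ (Finset.mem_univ (i, s)))) (repr_faceCenter b i s)
  ext X
  constructor
  · rintro ⟨i, s, h⟩
    exact ⟨_, Finset.mem_image_of_mem _ (Finset.mem_univ (i, s)), fun j => by rw [h, key]⟩
  · rintro ⟨u, hu, h⟩
    obtain ⟨⟨i, s⟩, -, rfl⟩ := Finset.mem_image.1 hu
    exact ⟨i, s, ext_repr b fun j => by rw [h, key]⟩

theorem EO_eq : EO b = directionSet b edgeVectors 2 := by
  have key : ∀ ε i j, b.repr (radial (edgeMidpoint b ε i)) j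
      = ((if j = i then 0 else (ε j : ℤ) : ℤ) : ℝ) / √(2 : ℕ) := fun ε i =>
    repr_radial b (by positivity) (edgeVectors_norm _
      (Finset.mem_image_of_mem _ (Finset.mem_univ (ε, i)))) (repr_edgeMidpoint b ε i)
  ext X
  constructor
  · rintro ⟨ε, i, h⟩
    exact ⟨_, Finset.mem_image_of_mem _ (Finset.mem_univ (ε, i)), fun j => by rw [h, key]⟩
  · rintro ⟨u, hu, h⟩
    obtain ⟨⟨ε, i⟩, -, rfl⟩ := Finset.mem_image.1 hu
    exact ⟨ε, i, ext_repr b fun j => by rw [h, key]⟩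

/-- Unit length forces c = ±1/√n; a negative sign is absorbed by passing to -u. -/
theorem mem_directionSet_of_parallel {U : Finset (Fin 3 → ℤ)} {n : ℕ} (hn : n ≠ 0)
    (hU : ∀ u ∈ U, u 0 ^ 2 + u 1 ^ 2 + u 2 ^ 2 = n) (hneg : ∀ u ∈ U, -u ∈ U) {X : S2}
    {u : Fin 3 → ℤ} (hu : u ∈ U) {c : ℝ} (h : ∀ i, b.repr X.1 i = c * u i) :
    X ∈ directionSet b U n := by
  have hn' : (0 : ℝ) < n := by positivity
  have h1 := norm_sq_eq_repr b X.1
  have h2 : (u 0 ^ 2 + u 1 ^ 2 + u 2 ^ 2 : ℝ) = n := by exact_mod_cast hU u hu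
  rw [h, h, h, mul_pow, mul_pow, mul_pow, ← mul_add, ← mul_add, h2, norm_eq_of_mem_sphere,
    one_pow] at h1
  have h3 : (c * √n) ^ 2 = 1 := by rw [mul_pow, Real.sq_sqrt hn'.le, ← h1]
  have hs : √(n : ℝ) ≠ 0 := by positivity
  rcases sq_eq_one_iff.1 h3 with h4 | h4
  · refine ⟨u, hu, fun i => ?_⟩
    rw [h, eq_div_iff hs]
    linear_combination (u i : ℝ) * h4
  · refine ⟨-u, hneg u hu, fun i => ?_⟩
    rw [h, eq_div_iff hs]
    push_cast [Pi.neg_apply]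
    linear_combination (u i : ℝ) * h4

/-- The points fixed by a non-trivial rotation of the cube are on the axes of the cube. -/
theorem mem_of_octHom_eq {π : Equiv.Perm (Fin 4)} (hπ : π ≠ 1) {X : S2}
    (hX : octHom b π X = X) : X ∈ VO b ∪ FO b ∪ EO b := by
  -- By Rodrigues' formula, R + Rᵀ = (t - 1)I + (3 - t)uuᵀ/|u|² for a rotation with axis u and trace
  -- t. Applied to X with RX = RᵀX = X, it shows that X is parallel to u, since t ≠ 3.
  obtain ⟨u, hu, hax⟩ := octMatrix_axis π hπ
  have htr : ((octMatrix π).trace : ℝ) ≠ 3 := by exact_mod_cast octMatrix_trace π hπ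
  have h1 : ∀ i, ∑ j, (octMatrix π i j : ℝ) * b.repr X.1 j = b.repr X.1 i := fun i => by
    rw [← repr_octRotation, ← octHom_apply, hX]
  have h2 : ∀ i, ∑ j, (octMatrix π j i : ℝ) * b.repr X.1 j = b.repr X.1 i := fun i => by
    have horth : ∀ k, ∑ j, (octMatrix π j i : ℝ) * octMatrix π j k = if i = k then 1 else 0 := by
      intro k
      have := congrFun (congrFun (octMatrix_transpose_mul π) i) k
      rw [Matrix.mul_apply, Matrix.one_apply] at this
      simp only [Matrix.transpose_apply] at this
      exact_mod_cast this
    calc ∑ j, (octMatrix π j i : ℝ) * b.repr X.1 j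
        = ∑ j, (octMatrix π j i : ℝ) * ∑ k, (octMatrix π j k : ℝ) * b.repr X.1 k := by
          simp only [h1]
      _ = ∑ k, (∑ j, (octMatrix π j i : ℝ) * octMatrix π j k) * b.repr X.1 k := by
          simp only [Fin.sum_univ_three]; ring
      _ = b.repr X.1 i := by simp [horth]
  set t : ℝ := ((octMatrix π).trace : ℝ) with ht
  have h3 : ∀ i, (u 0 ^ 2 + u 1 ^ 2 + u 2 ^ 2 : ℝ) * (3 - t) * b.repr X.1 i
      = (3 - t) * (u 0 * b.repr X.1 0 + u 1 * b.repr X.1 1 + u 2 * b.repr X.1 2) * u i := by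
    intro i
    have hax' : ∀ j, (u 0 ^ 2 + u 1 ^ 2 + u 2 ^ 2 : ℝ) * (octMatrix π i j + octMatrix π j i)
        = (u 0 ^ 2 + u 1 ^ 2 + u 2 ^ 2 : ℝ) * (t - 1) * (if i = j then 1 else 0)
          + (3 - t) * u i * u j := fun j => by
      have := hax i j
      rw [Matrix.one_apply] at this
      rw [ht]
      exact_mod_cast this
    have e1 := h1 i
    have e2 := h2 i
    have e3 : ∑ j, (if i = j then (1 : ℝ) else 0) * b.repr X.1 j = b.repr X.1 i := by simp
    rw [Fin.sum_univ_three] at e1 e2 e3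
    linear_combination -(u 0 ^ 2 + u 1 ^ 2 + u 2 ^ 2 : ℝ) * (e1 + e2)
      + (u 0 ^ 2 + u 1 ^ 2 + u 2 ^ 2 : ℝ) * (t - 1) * e3
      + b.repr X.1 0 * hax' 0 + b.repr X.1 1 * hax' 1 + b.repr X.1 2 * hax' 2
  have h4 : (u 0 ^ 2 + u 1 ^ 2 + u 2 ^ 2 : ℝ) ≠ 0 := by
    have : u 0 ^ 2 + u 1 ^ 2 + u 2 ^ 2 ≠ 0 := by
      rcases Finset.mem_union.1 hu with hu | hu
      · rcases Finset.mem_union.1 hu with hu | hu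
        · rw [vertexVectors_norm u hu]; norm_num
        · rw [faceVectors_norm u hu]; norm_num
      · rw [edgeVectors_norm u hu]; norm_num
    exact_mod_cast this
  have h5 : ∀ i, b.repr X.1 i = ((u 0 * b.repr X.1 0 + u 1 * b.repr X.1 1 + u 2 * b.repr X.1 2)
      / (u 0 ^ 2 + u 1 ^ 2 + u 2 ^ 2 : ℝ)) * u i := fun i => by
    have h6 : 3 - t ≠ 0 := sub_ne_zero.2 htr.symm
    have := h3 i
    rw [div_mul_eq_mul_div, eq_div_iff h4]
    apply mul_left_cancel₀ h6
    linear_combination this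
  rw [VO_eq, FO_eq, EO_eq]
  rcases Finset.mem_union.1 hu with hu | hu
  · rcases Finset.mem_union.1 hu with hu | hu
    · exact Or.inl (Or.inl (mem_directionSet_of_parallel b (by norm_num) vertexVectors_norm
        vertexVectors_neg hu h5))
    · exact Or.inl (Or.inr (mem_directionSet_of_parallel b (by norm_num) faceVectors_norm
        faceVectors_neg hu h5))
  · exact Or.inr (mem_directionSet_of_parallel b (by norm_num) edgeVectors_norm
      edgeVectors_neg hu h5)

end Cube

/-! ### Orbits, maximality of the octahedral group, and the classification -/

section Main
open MulAction

variable (b : OrthonormalBasis (Fin 3) ℝ E3)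

theorem ncard_VO : (VO b).ncard = 8 := by
  rw [VO_eq, ncard_directionSet b (by norm_num) vertexVectors_norm, card_vertexVectors]

theorem ncard_FO : (FO b).ncard = 6 := by
  rw [FO_eq, ncard_directionSet b (by norm_num) faceVectors_norm, card_faceVectors]

theorem ncard_EO : (EO b).ncard = 12 := by
  rw [EO_eq, ncard_directionSet b (by norm_num) edgeVectors_norm, card_edgeVectors]

theorem orbit_eq_VO {X : S2} (hX : X ∈ VO b) : orbit (octahedralGroup b) X = VO b := by
  rw [VO_eq] at hX ⊢
  exact orbit_eq_directionSet b vertexVectors_transitive hX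

theorem orbit_eq_FO {X : S2} (hX : X ∈ FO b) : orbit (octahedralGroup b) X = FO b := by
  rw [FO_eq] at hX ⊢
  exact orbit_eq_directionSet b faceVectors_transitive hX

theorem orbit_eq_EO {X : S2} (hX : X ∈ EO b) : orbit (octahedralGroup b) X = EO b := by
  rw [EO_eq] at hX ⊢
  exact orbit_eq_directionSet b edgeVectors_transitive hX

theorem ncard_orbit_mul_card_stabilizer (X : S2) :
    (orbit (octahedralGroup b) X).ncard * Nat.card (stabilizer (octahedralGroup b) X) = 24 := by
  have h := Nat.card_congr (orbitProdStabilizerEquivGroup (octahedralGroup b) X)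
  rwa [Nat.card_prod, card_octahedralGroup] at h

theorem stabilizer_eq_bot {X : S2} (hX : X ∉ VO b ∪ FO b ∪ EO b) :
    stabilizer (octahedralGroup b) X = ⊥ := by
  rw [Subgroup.eq_bot_iff_forall]
  rintro ⟨g, hg⟩ hgX
  have hg' := hg
  rw [← octHom_range] at hg'
  obtain ⟨π, rfl⟩ := hg'
  by_cases hπ : π = 1
  · exact Subtype.ext (by simp [hπ])
  · exact (hX (mem_of_octHom_eq b hπ hgX)).elim

theorem ncard_BO {X : S2} (hX : X ∉ VO b ∪ FO b ∪ EO b) : (BO b X).ncard = 24 := by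
  have h := ncard_orbit_mul_card_stabilizer b X
  rwa [stabilizer_eq_bot b hX, Subgroup.card_bot, mul_one] at h

/-- Lagrange's theorem, as the smaller stabilizer embeds in the larger. It passes the orders 3 and 4
on to H. -/
theorem card_stabilizer_dvd {H : Subgroup (Equiv.Perm S2)} (hH : octahedralGroup b ≤ H) (X : S2) :
    Nat.card (stabilizer (octahedralGroup b) X) ∣ Nat.card (stabilizer H X) := by
  refine Subgroup.card_dvd_of_injective
    (((Subgroup.inclusion hH).comp (stabilizer (octahedralGroup b) X).subtype).codRestrict
      (stabilizer H X) fun g => g.2) ?_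
  intro g g' h
  exact Subtype.ext (Subgroup.inclusion_injective hH (congrArg Subtype.val h))

/-- The octahedral group is maximal among the finite groups of linear fractional
transformations. -/
theorem eq_octahedralGroup_of_le {H : Subgroup (Equiv.Perm S2)} [Finite H]
    (hH : octahedralGroup b ≤ H) (hM : H ≤ sphereMoebius) : H = octahedralGroup b := by
  obtain ⟨v, hv⟩ : (VO b).Nonempty := Set.nonempty_of_ncard_ne_zero (by rw [ncard_VO]; norm_num)
  obtain ⟨f, hf⟩ : (FO b).Nonempty := Set.nonempty_of_ncard_ne_zero (by rw [ncard_FO]; norm_num)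
  have hv3 : Nat.card (stabilizer (octahedralGroup b) v) = 3 := by
    have h := ncard_orbit_mul_card_stabilizer b v
    rw [orbit_eq_VO b hv, ncard_VO] at h
    omega
  have hf4 : Nat.card (stabilizer (octahedralGroup b) f) = 4 := by
    have h := ncard_orbit_mul_card_stabilizer b f
    rw [orbit_eq_FO b hf, ncard_FO] at h
    omega
  have hfix : ∀ h : H, h ≠ 1 → (fixedBy S2 h).ncard = 2 := fun h hh =>
    sphereMoebius_ncard_fixed (hM h.2) (fun e => hh (Subtype.ext e))
      (H.subtype.isOfFinOrder (isOfFinOrder_of_finite h))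
  have hf2 : 2 < Nat.card (orbit H f) := by
    have hsub : FO b ⊆ orbit H f := by
      rw [← orbit_eq_FO b hf]
      rintro _ ⟨g, rfl⟩
      exact ⟨Subgroup.inclusion hH g, rfl⟩
    have := Set.ncard_le_ncard hsub (Set.finite_range _)
    rw [ncard_FO] at this
    change 6 ≤ Nat.card (orbit H f) at this
    omega
  have h24 := card_eq_of_fixed_points hfix v f (hv3 ▸ card_stabilizer_dvd b hH v)
    (hf4 ▸ card_stabilizer_dvd b hH f) hf2
  exact (Subgroup.eq_of_le_of_card_ge hH (by rw [h24, card_octahedralGroup])).symm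

theorem orbit_mem_classes (X : S2) : orbit (octahedralGroup b) X ∈
    ({VO b, FO b, EO b} ∪ {B | ∃ X : S2, X ∉ VO b ∪ FO b ∪ EO b ∧ B = BO b X} : Set (Set S2)) := by
  by_cases hX : X ∈ VO b ∪ FO b ∪ EO b
  · left
    rcases hX with (hX | hX) | hX
    · simp [orbit_eq_VO b hX]
    · simp [orbit_eq_FO b hX]
    · simp [orbit_eq_EO b hX]
  · exact Or.inr ⟨X, hX, rfl⟩

/-- The size bound supplies the three points that make `fixGroup` finite. -/
theorem orbit_eq_of_mem_classes {B : Set S2}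
    (hB : B ∈ ({VO b, FO b, EO b} ∪
      {B | ∃ X : S2, X ∉ VO b ∪ FO b ∪ EO b ∧ B = BO b X} : Set (Set S2)))
    {X : S2} (hX : X ∈ B) : orbit (octahedralGroup b) X = B ∧ 2 < B.ncard := by
  rcases hB with (rfl | rfl | rfl) | ⟨Y, hY, rfl⟩
  · exact ⟨orbit_eq_VO b hX, by rw [ncard_VO]; norm_num⟩
  · exact ⟨orbit_eq_FO b hX, by rw [ncard_FO]; norm_num⟩
  · exact ⟨orbit_eq_EO b hX, by rw [ncard_EO]; norm_num⟩
  · exact ⟨orbit_eq_iff.2 hX, by rw [ncard_BO b hY]; norm_num⟩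

theorem octahedralGroup_le_fixGroup {α : Set S2}
    (hα : ∀ X ∈ α, orbit (octahedralGroup b) X ⊆ α) : octahedralGroup b ≤ fixGroup α := by
  intro g hg
  refine mem_fixGroup.2 ⟨octahedralGroup_le_sphereMoebius b hg, Set.Subset.antisymm ?_ ?_⟩
  · rintro _ ⟨X, hX, rfl⟩
    exact hα X hX ⟨⟨g, hg⟩, rfl⟩
  · intro X hX
    exact ⟨g⁻¹ X, hα X hX ⟨⟨g⁻¹, inv_mem hg⟩, rfl⟩, by simp⟩

end Main

end OctahedralOrbits
end

open OctahedralOrbits in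
theorem mainTheorem6 (b : OrthonormalBasis (Fin 3) ℝ E3) :
    Nonempty (octahedralGroup b ≃* Equiv.Perm (Fin 4)) ∧
    ((VO b).ncard = 8 ∧ ∀ X ∈ VO b, MulAction.orbit (octahedralGroup b) X = VO b) ∧
    ((FO b).ncard = 6 ∧ ∀ X ∈ FO b, MulAction.orbit (octahedralGroup b) X = FO b) ∧
    ((EO b).ncard = 12 ∧ ∀ X ∈ EO b, MulAction.orbit (octahedralGroup b) X = EO b) ∧
    (∀ X : S2, X ∉ VO b ∪ FO b ∪ EO b →
      MulAction.stabilizer (octahedralGroup b) X = ⊥ ∧ (BO b X).ncard = 24) ∧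
    ∀ α : Set S2, α.Finite → α.Nonempty →
      (fixGroup α = octahedralGroup b ↔
        ∃ C : Set (Set S2),
          C ⊆ {VO b, FO b, EO b} ∪ {B | ∃ X : S2, X ∉ VO b ∪ FO b ∪ EO b ∧ B = BO b X} ∧
            α = ⋃₀ C) := by
  refine ⟨⟨octahedralGroupEquiv b⟩, ⟨ncard_VO b, fun X => orbit_eq_VO b⟩,
    ⟨ncard_FO b, fun X => orbit_eq_FO b⟩, ⟨ncard_EO b, fun X => orbit_eq_EO b⟩,
    fun X hX => ⟨stabilizer_eq_bot b hX, ncard_BO b hX⟩, fun α hα hne => ⟨fun h => ?_, ?_⟩⟩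
  -- An invariant set is the union of the orbits of its points.
  · refine ⟨(fun X => MulAction.orbit (octahedralGroup b) X) '' α, ?_, ?_⟩
    · rintro _ ⟨X, -, rfl⟩
      exact orbit_mem_classes b X
    · apply Set.Subset.antisymm
      · exact fun X hX => ⟨_, ⟨X, hX, rfl⟩, MulAction.mem_orbit_self X⟩
      · rintro _ ⟨_, ⟨X, hX, rfl⟩, ⟨g, rfl⟩⟩
        have hg : g.1 ∈ fixGroup α := h.ge g.2
        exact (mem_fixGroup.1 hg).2.subset ⟨X, hX, rfl⟩
  · rintro ⟨C, hC, rfl⟩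
    obtain ⟨X, B, hB, hX⟩ := hne
    have : Finite (fixGroup (⋃₀ C)) := finite_fixGroup hα
      ((orbit_eq_of_mem_classes b (hC hB) hX).2.trans_le
        (Set.ncard_le_ncard (Set.subset_sUnion_of_mem hB) hα))
    refine eq_octahedralGroup_of_le b (octahedralGroup_le_fixGroup b ?_)
      fun f hf => (mem_fixGroup.1 hf).1
    rintro Y ⟨B', hB', hY⟩
    rw [(orbit_eq_of_mem_classes b (hC hB') hY).1]
    exact Set.subset_sUnion_of_mem hB'
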